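/- Let $N\ge 2$ and let $T[0..N-1]$ be a table of $N$ distinct values from a totally ordered set. Consider the following algorithm, which uses two quantum registers, each ranging over the indices $0,\dots,N-1$. 1. Choose a threshold index $0\le y\le N-1$ uniformly at random. 2. Repeat (a)–(c). As soon as the total running time is more than $22.5\sqrt N+1.4\lg^2N$ (binary logarithm), interrupt this loop, carry out (c) once more on the current state, and go to 3. (a) Initialize the memory as $\sum_j\frac1{\sqrt N}|j\rangle|y\rangle$. An item $j$ is marked if $T[j]<T[y]$. (b) Apply the exponential quantum search of Boyer, Brassard, Høyer and Tapp: set $m=1$; choose an integer $0\le j<m$ uniformly at random; apply $j$ Grover iterations (sign change of the marked items, followed by inversion about the mean on the first register) to the state $\sum_i\frac1{\sqrt N}|i\rangle|y\rangle$; observe the first register; if the outcome is a marked item, the search ends; otherwise replace $m$ by $\min(\frac65m,\sqrt N)$ and continue with a new choice of $j$. (c) Observe the first register, with outcome $y'$. If $T[y']<T[y]$, set $y$ to $y'$. 3. Return $y$. Stage (a) takes $\lg N$ time steps, each Grover iteration takes one time step, and all other work is not counted. A probe is counted for each execution of (a), for each Grover iteration, and for each comparison of an observed item with the threshold item. Then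 the algorithm halts with probability 1, and it returns the index of the minimum value of $T$ with probability at least $\frac12$. Moreover, there is a constant $C$, independent of $N$ and $T$, such that the running time never exceeds $C\sqrt N$ and the expected number of probes is at most $C\sqrt N$. -/

import Mathlib

open scoped ENNReal

noncomputable section

namespace QuantumMinimum

/-- State space of the two quantum registers: `ψ (j, y)` is the amplitude of `|j⟩|y⟩`. -/
abbrev Memory (N : ℕ) : Type := EuclideanSpace ℂ (Fin N × Fin N)

/-- Quantum states are the unit vectors. -/
abbrev QState (N : ℕ) : Type := {ψ : Memory N // ‖ψ‖ = 1}

theorem norm_eq_of_sum {N : ℕ} {φ ψ : Memory N}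
    (h : ∀ y, ∑ j, ‖φ (j, y)‖ ^ 2 = ∑ j, ‖ψ (j, y)‖ ^ 2) : ‖φ‖ = ‖ψ‖ := by
  rw [EuclideanSpace.norm_eq, EuclideanSpace.norm_eq, Fintype.sum_prod_type_right,
    Fintype.sum_prod_type_right, Finset.sum_congr rfl fun y _ => h y]

theorem sum_norm_sq_reflect {N : ℕ} (f : Fin N → ℂ) :
    ∑ j, ‖2 / (N : ℂ) * ∑ i, f i - f j‖ ^ 2 = ∑ j, ‖f j‖ ^ 2 := by
  rcases Nat.eq_zero_or_pos N with rfl | hN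
  · simp
  have hN' : (N : ℝ) ≠ 0 := by positivity
  have key : ∀ g : Fin N → ℝ,
      ∑ j, (2 / (N : ℝ) * ∑ i, g i - g j) ^ 2 = ∑ j, g j ^ 2 := by
    intro g
    simp only [sub_sq, Finset.sum_add_distrib, Finset.sum_sub_distrib, ← Finset.mul_sum,
      Finset.sum_const, Finset.card_univ, Fintype.card_fin, nsmul_eq_mul]
    field_simp
    ring
  have hsq : ∀ z : ℂ, ‖z‖ ^ 2 = z.re ^ 2 + z.im ^ 2 := by
    intro z
    rw [Complex.sq_norm, Complex.normSq_apply]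
    ring
  have hc : (2 / (N : ℂ)) = ((2 / (N : ℝ) : ℝ) : ℂ) := by push_cast; rfl
  simp only [hsq, Finset.sum_add_distrib, hc, Complex.sub_re, Complex.sub_im,
    Complex.re_ofReal_mul, Complex.im_ofReal_mul, Complex.re_sum, Complex.im_sum, key]

/-- The marking of the items with a value below the threshold, as a phase oracle:
`|j⟩|y⟩ ↦ -|j⟩|y⟩` if `T j < T y`, and `|j⟩|y⟩ ↦ |j⟩|y⟩` otherwise. -/
def oracle {N : ℕ} {α : Type*} [LinearOrder α] (T : Fin N → α) : Memory N →ₗᵢ[ℂ] Memory N where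
  toFun ψ := WithLp.toLp 2 fun p => if T p.1 < T p.2 then -ψ p else ψ p
  map_add' φ ψ := by
    ext p
    by_cases h : T p.1 < T p.2 <;> simp [h]
    ring
  map_smul' c ψ := by
    ext p
    by_cases h : T p.1 < T p.2 <;> simp [h]
  norm_map' ψ := by
    refine norm_eq_of_sum fun y => Finset.sum_congr rfl fun j _ => ?_
    by_cases h : T j < T y <;> simp [h]

/-- Inversion about the mean, `2 |u⟩⟨u| - 1` with `|u⟩ = ∑ j, |j⟩ / √N`, on the first register. -/
def diffusion (N : ℕ) : Memory N →ₗᵢ[ℂ] Memory N where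
  toFun ψ := WithLp.toLp 2 fun p => 2 / (N : ℂ) * ∑ i, ψ (i, p.2) - ψ p
  map_add' φ ψ := by
    ext p
    simp [Finset.sum_add_distrib]
    ring
  map_smul' c ψ := by
    ext p
    simp [← Finset.mul_sum]
    ring
  norm_map' ψ := norm_eq_of_sum fun y => sum_norm_sq_reflect fun j => ψ (j, y)

/-- One Grover iteration. -/
def groverStep {N : ℕ} {α : Type*} [LinearOrder α] (T : Fin N → α) (ψ : QState N) : QState N :=
  ⟨diffusion N (oracle T ψ.1), by
    rw [LinearIsometry.norm_map, LinearIsometry.norm_map, ψ.2]⟩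

/-- The state `∑ j, (1 / √N) |j⟩|y⟩`. -/
def initState {N : ℕ} (y : Fin N) : QState N :=
  ⟨WithLp.toLp 2 fun p => if p.2 = y then ((1 / √(N : ℝ) : ℝ) : ℂ) else 0, by
    have hN : (N : ℝ) ≠ 0 := by
      have := y.pos
      positivity
    rw [EuclideanSpace.norm_eq, Fintype.sum_prod_type]
    simp [apply_ite, abs_of_nonneg, hN]⟩

/-- The basis state `|j⟩|y⟩`. -/
def basisState {N : ℕ} (j y : Fin N) : QState N :=
  ⟨EuclideanSpace.single (j, y) 1, by simp⟩

/-- Observation of the first register (Born rule): the outcome is `j` with probability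
`∑ y, |ψ (j, y)|²`. -/
def observeFirst {N : ℕ} (ψ : QState N) : PMF (Fin N) :=
  PMF.ofFintype (fun j => ENNReal.ofReal (∑ y, ‖ψ.1 (j, y)‖ ^ 2)) (by
    rw [← ENNReal.ofReal_sum_of_nonneg fun j _ => by positivity,
      ← Fintype.sum_prod_type (f := fun p => ‖ψ.1 p‖ ^ 2), ← EuclideanSpace.norm_sq_eq, ψ.2]
    simp)

/-- The parameter `m` of the exponential search in its round `s`: `m = 1` in the first round, and
`m` is replaced by `min (6/5 * m) √N` after each unsuccessful round. -/
def roundBound (N : ℕ) : ℕ → ℝ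
  | 0 => 1
  | s + 1 => min (6 / 5 * roundBound N s) √(N : ℝ)

theorem roundBound_pos {N : ℕ} (hN : 0 < N) : ∀ s, 0 < roundBound N s
  | 0 => one_pos
  | s + 1 => lt_min (mul_pos (by norm_num) (roundBound_pos hN s))
      (Real.sqrt_pos.2 (Nat.cast_pos.2 hN))

/-- Uniform choice among the nonnegative integers smaller than `m` in round `s`. -/
def chooseIterations {N : ℕ} (hN : 0 < N) (s : ℕ) : PMF ℕ :=
  PMF.uniformOfFinset (Finset.range ⌈roundBound N s⌉₊)
    (Finset.nonempty_range_iff.2 (Nat.ceil_pos.2 (roundBound_pos hN s)).ne')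

/-- The time-out of the algorithm. -/
def timeLimit (N : ℕ) : ℝ := 22.5 * √(N : ℝ) + 1.4 * Real.logb 2 N ^ 2

/-- Control state of the algorithm. -/
inductive Stage (N : ℕ) : Type
  /-- about to initialize the memory and start a new exponential search -/
  | prepare
  /-- exponential search: about to begin round `s` -/
  | round (s : ℕ)
  /-- exponential search, round `s`: `j` Grover iterations remain to be applied to `ψ`, and then
  the first register is observed -/
  | grover (s j : ℕ) (ψ : QState N)
  /-- the search has ended or was interrupted in state `ψ`: about to observe the first register
  and to update the threshold -/
  | observe (ψ : QState N)
  /-- the algorithm has returned the threshold index -/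
  | halted

/-- Configuration: control state, threshold index, running time so far, and the number of
probes so far (one for each marking of the items, each Grover iteration, and each comparison of
an observed item with the threshold item). -/
structure Config (N : ℕ) : Type where
  stage : Stage N
  threshold : Fin N
  time : ℝ
  probes : ℕ

/-- One step of the algorithm. Initialization takes time `lg N`, a Grover iteration takes
time `1`, everything else is free. As soon as the time exceeds the limit, the current search is
interrupted, the first register is observed, the threshold is updated, and the algorithm halts. -/
def step {N : ℕ} {α : Type*} [LinearOrder α] (T : Fin N → α) : Config N → PMF (Config N)
  | ⟨.prepare, y, t, q⟩ =>
      let t' := t + Real.logb 2 N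
      PMF.pure ⟨if timeLimit N < t' then .observe (initState y) else .round 0, y, t', q + 1⟩
  | ⟨.round s, y, t, q⟩ =>
      (chooseIterations y.pos s).bind fun j => PMF.pure ⟨.grover s j (initState y), y, t, q⟩
  | ⟨.grover s (j + 1) ψ, y, t, q⟩ =>
      let t' := t + 1
      PMF.pure ⟨if timeLimit N < t' then .observe (groverStep T ψ)
        else .grover s j (groverStep T ψ), y, t', q + 1⟩
  | ⟨.grover s 0 ψ, y, t, q⟩ =>
      (observeFirst ψ).bind fun i =>
        PMF.pure ⟨if T i < T y then .observe (basisState i y) else .round (s + 1), y, t, q + 1⟩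
  | ⟨.observe ψ, y, t, q⟩ =>
      (observeFirst ψ).bind fun y' =>
        PMF.pure ⟨if timeLimit N < t then .halted else .prepare,
          if T y' < T y then y' else y, t, q + 1⟩
  | ⟨.halted, y, t, q⟩ => PMF.pure ⟨.halted, y, t, q⟩

/-- Law of the configuration after `n` steps; the first threshold index is uniformly random. -/
def run {N : ℕ} [NeZero N] {α : Type*} [LinearOrder α] (T : Fin N → α) : ℕ → PMF (Config N)
  | 0 => (PMF.uniformOfFintype (Fin N)).bind fun y => PMF.pure ⟨.prepare, y, 0, 0⟩
  | n + 1 => (run T n).bind (step T)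

/-- Probability that the algorithm halts and returns `y`. -/
def returnProb {N : ℕ} [NeZero N] {α : Type*} [LinearOrder α] (T : Fin N → α) (y : Fin N) :
    ℝ≥0∞ :=
  ⨆ n, (run T n).toOuterMeasure {c | c.stage = .halted ∧ c.threshold = y}

/-- Expected total number of probes; the number of probes does not decrease along a run, so this
is the limit of the expected numbers of probes in the first `n` steps. -/
def expectedProbes {N : ℕ} [NeZero N] {α : Type*} [LinearOrder α] (T : Fin N → α) : ℝ≥0∞ :=
  ⨆ n, ∑' c, run T n c * (c.probes : ℝ≥0∞)

end QuantumMinimum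

end

/-! A Markov argument on the time needed to reach the minimum. Within a search with `t` marked items
a Grover iteration is a rotation by `2θ`, where `sin² θ = t / N` (`grover_amplitude`). A round whose
parameter has reached `√(N / (3t))` therefore succeeds with probability at least `1/4`
(`sum_cos_sq_groverAngle_le`), and since `3/4 * 6/5 < 1` the expected cost of the search is a
geometric sum of order `√(N / t)` (`roundCost_succ_le`).

A successful observation is uniform on the marked items, so the rank drops to a uniform smaller
value. The resulting recursion weights the search cost at rank `i` by `1 / (i + 1)`, the chance that
this rank ever occurs (`sum_indexCost`). Summing gives an expected time of at most half the time
limit (`averageCost_le`).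

For the interrupted algorithm, elapsed time plus expected remaining time is a supermartingale, set
to zero once the minimum is found (`mean_step_lateness_le`). It is at least the limit after halting
with a wrong threshold, so that event has probability at most `1/2`.

A second supermartingale charges three probes to each unit of time and bounds the expected number of
probes (`mean_step_probeBudget_le`). A run that does not halt uses a probe at least every other
step, so bounded expected probes also force halting with probability 1. -/

open scoped ENNReal

noncomputable section

namespace QuantumMinimum

/-! ### Expectations with respect to a probability mass function -/

section Mean

variable {β γ : Type*}

/-- The expectation of a nonnegative function. -/
def mean (p : PMF β) (f : β → ℝ≥0∞) : ℝ≥0∞ := ∑' b, p b * f b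

theorem mean_pure (b : β) (f : β → ℝ≥0∞) : mean (PMF.pure b) f = f b := by
  rw [mean, tsum_eq_single b]
  · simp
  · intro c hc
    simp [PMF.pure_apply, hc]

theorem mean_bind (p : PMF β) (k : β → PMF γ) (f : γ → ℝ≥0∞) :
    mean (p.bind k) f = mean p fun b => mean (k b) f := by
  simp only [mean, PMF.bind_apply, ← ENNReal.tsum_mul_right, ← ENNReal.tsum_mul_left, mul_assoc]
  exact ENNReal.tsum_comm

theorem mean_mono_on {p : PMF β} {f g : β → ℝ≥0∞} (h : ∀ b ∈ p.support, f b ≤ g b) :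
    mean p f ≤ mean p g := by
  refine ENNReal.tsum_le_tsum fun b => ?_
  by_cases hb : p b = 0
  · simp [hb]
  · exact mul_le_mul_right (h b ((PMF.mem_support_iff p b).2 hb)) _

theorem mean_mono {p : PMF β} {f g : β → ℝ≥0∞} (h : ∀ b, f b ≤ g b) : mean p f ≤ mean p g :=
  mean_mono_on fun b _ => h b

theorem mean_const (p : PMF β) (a : ℝ≥0∞) : mean p (fun _ => a) = a := by
  rw [mean, ENNReal.tsum_mul_right, p.tsum_coe, one_mul]

theorem mean_add (p : PMF β) (f g : β → ℝ≥0∞) :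
    mean p (fun b => f b + g b) = mean p f + mean p g := by
  simp only [mean, mul_add, ENNReal.tsum_add]

theorem mean_le_of_forall {p : PMF β} {f : β → ℝ≥0∞} {a : ℝ≥0∞}
    (h : ∀ b ∈ p.support, f b ≤ a) : mean p f ≤ a :=
  (mean_mono_on h).trans_eq (mean_const p a)

/-- Markov's inequality. -/
theorem mul_toOuterMeasure_le_mean (p : PMF β) {f : β → ℝ≥0∞} {s : Set β} {a : ℝ≥0∞}
    (h : ∀ b ∈ p.support, b ∈ s → a ≤ f b) : a * p.toOuterMeasure s ≤ mean p f := by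
  rw [PMF.toOuterMeasure_apply, ← ENNReal.tsum_mul_left]
  refine ENNReal.tsum_le_tsum fun b => ?_
  by_cases hb : b ∈ s
  · rw [Set.indicator_of_mem hb, mul_comm]
    by_cases hp : p b = 0
    · simp [hp]
    · exact mul_le_mul_right (h b ((PMF.mem_support_iff p b).2 hp) hb) _
  · simp [hb]

theorem toOuterMeasure_eq_mean (p : PMF β) (s : Set β) :
    p.toOuterMeasure s = mean p (s.indicator fun _ => 1) := by
  rw [PMF.toOuterMeasure_apply]
  refine tsum_congr fun b => ?_
  by_cases hb : b ∈ s <;> simp [hb]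

theorem mean_uniformOfFinset (s : Finset β) (hs : s.Nonempty) {f : β → ℝ}
    (hf : ∀ b, 0 ≤ f b) :
    mean (PMF.uniformOfFinset s hs) (fun b => ENNReal.ofReal (f b)) =
      ENNReal.ofReal ((∑ b ∈ s, f b) / s.card) := by
  have hc : (0 : ℝ) < s.card := by exact_mod_cast hs.card_pos
  rw [mean, tsum_eq_sum (s := s) fun b hb => by simp [hb], Finset.sum_div,
    ENNReal.ofReal_sum_of_nonneg fun b _ => div_nonneg (hf b) hc.le]
  refine Finset.sum_congr rfl fun b hb => ?_
  rw [PMF.uniformOfFinset_apply_of_mem hs hb, ENNReal.ofReal_div_of_pos hc, ENNReal.ofReal_natCast,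
    ENNReal.div_eq_inv_mul]

end Mean

/-! ### Observation of the first register -/

/-- The probability that the first register is observed to be `i`. -/
def outcomeProb {N : ℕ} (ψ : QState N) (i : Fin N) : ℝ := ∑ y, ‖ψ.1 (i, y)‖ ^ 2

theorem outcomeProb_nonneg {N : ℕ} (ψ : QState N) (i : Fin N) : 0 ≤ outcomeProb ψ i :=
  Finset.sum_nonneg fun _ _ => by positivity

theorem mean_observeFirst {N : ℕ} (ψ : QState N) {f : Fin N → ℝ} (hf : ∀ i, 0 ≤ f i) :
    mean (observeFirst ψ) (fun i => ENNReal.ofReal (f i)) =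
      ENNReal.ofReal (∑ i, outcomeProb ψ i * f i) := by
  rw [mean, tsum_fintype, ENNReal.ofReal_sum_of_nonneg fun i _ =>
    mul_nonneg (outcomeProb_nonneg ψ i) (hf i)]
  refine Finset.sum_congr rfl fun i _ => ?_
  rw [ENNReal.ofReal_mul (outcomeProb_nonneg ψ i)]
  rfl

theorem outcomeProb_basisState {N : ℕ} (j y i : Fin N) :
    outcomeProb (basisState j y) i = if i = j then 1 else 0 := by
  by_cases h : i = j <;> simp [outcomeProb, basisState, h, Prod.ext_iff, apply_ite]

/-! ### Ranks -/

section Rank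

variable {N : ℕ} {α : Type*} [LinearOrder α] (T : Fin N → α)

/-- The number of items below the item `y`. -/
def rank (y : Fin N) : ℕ := (Finset.univ.filter fun j => T j < T y).card

theorem rank_lt (y : Fin N) : rank T y < N := by
  have h : (Finset.univ.filter fun j => T j < T y) ⊂ Finset.univ := by
    rw [Finset.filter_ssubset]
    exact ⟨y, Finset.mem_univ y, lt_irrefl _⟩
  simpa [rank] using Finset.card_lt_card h

theorem card_filter_not_lt (y : Fin N) :
    ((Finset.univ.filter fun j => ¬ T j < T y).card : ℝ) = N - rank T y := by
  have := Finset.card_filter_add_card_filter_not (s := (Finset.univ : Finset (Fin N)))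
    (fun j => T j < T y)
  rw [Finset.card_univ, Fintype.card_fin] at this
  rw [eq_sub_iff_add_eq, add_comm]
  exact_mod_cast this

theorem rank_eq_zero_iff {y : Fin N} : rank T y = 0 ↔ ∀ j, T y ≤ T j := by
  simp [rank, Finset.filter_eq_empty_iff]

theorem rank_lt_rank {i y : Fin N} (h : T i < T y) : rank T i < rank T y := by
  refine Finset.card_lt_card ⟨fun j hj => ?_, fun hs => ?_⟩
  · rw [Finset.mem_filter] at hj ⊢
    exact ⟨hj.1, hj.2.trans h⟩
  · have := hs (Finset.mem_filter.2 ⟨Finset.mem_univ i, h⟩)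
    exact lt_irrefl _ (Finset.mem_filter.1 this).2

variable {T}

theorem rank_injective (hT : Function.Injective T) : Function.Injective (rank T) := by
  intro i j h
  rcases lt_trichotomy (T i) (T j) with hl | he | hl
  · exact absurd h (rank_lt_rank T hl).ne
  · exact hT he
  · exact absurd h (rank_lt_rank T hl).ne'

/-- Distinct values make ranks injective, so the items below `y` carry each rank smaller than that
of `y` exactly once. -/
theorem sum_rank_lt (hT : Function.Injective T) (y : Fin N) (f : ℕ → ℝ) :
    ∑ i with T i < T y, f (rank T i) = ∑ k ∈ Finset.range (rank T y), f k := by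
  have himg : (Finset.univ.filter fun j => T j < T y).image (rank T) =
      Finset.range (rank T y) := by
    refine Finset.eq_of_subset_of_card_le (fun k hk => ?_) ?_
    · obtain ⟨i, hi, rfl⟩ := Finset.mem_image.1 hk
      exact Finset.mem_range.2 (rank_lt_rank T (Finset.mem_filter.1 hi).2)
    · rw [Finset.card_image_of_injective _ (rank_injective hT), Finset.card_range]
      rfl
  rw [← himg, Finset.sum_image fun i _ j _ h => rank_injective hT h]

theorem sum_rank (hT : Function.Injective T) (f : ℕ → ℝ) :
    ∑ i, f (rank T i) = ∑ k ∈ Finset.range N, f k := by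
  have himg : Finset.univ.image (rank T) = Finset.range N := by
    refine Finset.eq_of_subset_of_card_le (fun k hk => ?_) ?_
    · obtain ⟨i, -, rfl⟩ := Finset.mem_image.1 hk
      exact Finset.mem_range.2 (rank_lt T i)
    · rw [Finset.card_image_of_injective _ (rank_injective hT)]
      simp
  rw [← himg, Finset.sum_image fun i _ j _ h => rank_injective hT h]

end Rank

/-! ### Grover iterations on the uniform superposition -/

section Grover

variable {N : ℕ} {α : Type*} [LinearOrder α] (T : Fin N → α)

/-- The angle `θ` with `sin² θ = t / N`. -/
def groverAngle (N t : ℕ) : ℝ := Real.arcsin √(t / N : ℝ)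

theorem sin_groverAngle {t : ℕ} (h : t < N) : Real.sin (groverAngle N t) = √(t / N : ℝ) := by
  refine Real.sin_arcsin (by linarith [Real.sqrt_nonneg (t / N : ℝ)]) (Real.sqrt_le_one.2 ?_)
  have : (t : ℝ) ≤ N := by exact_mod_cast h.le
  exact div_le_one_of_le₀ this (by positivity)

theorem cos_groverAngle (t : ℕ) : Real.cos (groverAngle N t) = √(1 - t / N : ℝ) := by
  rw [groverAngle, Real.cos_arcsin, Real.sq_sqrt (by positivity)]

/-- Oracle and diffusion act as reflections on the plane spanned by the uniform superpositions of
marked and of unmarked items, so their composite rotates by `2θ`. The initial state sits at angle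
`θ`. The second register never changes. -/
theorem grover_amplitude (y : Fin N) (hy : rank T y ≠ 0) (j : ℕ) (i z : Fin N) :
    ((groverStep T)^[j] (initState y)).1 (i, z) =
      if z = y then
        (if T i < T y then
          ((Real.sin ((2 * j + 1) * groverAngle N (rank T y)) / √(rank T y : ℝ) : ℝ) : ℂ)
        else
          ((Real.cos ((2 * j + 1) * groverAngle N (rank T y)) / √(N - rank T y : ℝ) : ℝ) : ℂ))
      else 0 := by
  have hr := rank_lt T y
  have hs := sin_groverAngle hr
  have hc := cos_groverAngle (N := N) (rank T y)
  have hcard : (Finset.univ.filter fun j => T j < T y).card = rank T y := rfl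
  have hcard' := card_filter_not_lt T y
  set θ := groverAngle N (rank T y)
  set r : ℝ := ((rank T y : ℕ) : ℝ) with hrdef
  have hr0 : 0 < r := by rw [hrdef]; exact_mod_cast Nat.pos_of_ne_zero hy
  have hrN : 0 < (N : ℝ) - r := by rw [sub_pos, hrdef]; exact_mod_cast hr
  have hN : 0 < (N : ℝ) := by linarith
  have hs' : Real.sin θ = √r / √(N : ℝ) := by rw [hs, Real.sqrt_div hr0.le]
  have hc' : Real.cos θ = √((N : ℝ) - r) / √(N : ℝ) := by
    rw [hc, ← Real.sqrt_div hrN.le]; congr 1; field_simp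
  induction j generalizing i z with
  | zero =>
    have h1 := (Real.sqrt_pos.2 hr0).ne'
    have h2 := (Real.sqrt_pos.2 hrN).ne'
    simp only [Function.iterate_zero, id, initState, Nat.cast_zero, mul_zero, zero_add, one_mul,
      hs', hc']
    have e1 : √r / √(N : ℝ) / √r = 1 / √(N : ℝ) := by field_simp
    have e2 : √((N : ℝ) - r) / √(N : ℝ) / √((N : ℝ) - r) = 1 / √(N : ℝ) := by field_simp
    rw [e1, e2, ite_self]
  | succ j ih =>
    rw [Function.iterate_succ_apply']
    set ψ := (groverStep T)^[j] (initState y)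
    have hstep : (groverStep T ψ).1 (i, z) =
        2 / (N : ℂ) * ∑ k, (if T k < T z then -ψ.1 (k, z) else ψ.1 (k, z)) -
          (if T i < T z then -ψ.1 (i, z) else ψ.1 (i, z)) := rfl
    rw [hstep]
    by_cases hz : z = y
    · subst hz
      set a := (2 * (j : ℝ) + 1) * θ with ha
      have ha' : (2 * ((j + 1 : ℕ) : ℝ) + 1) * θ = a + 2 * θ := by rw [ha]; push_cast; ring
      rw [ha']
      simp only [ih, if_true]
      have hsum : ∑ k, (if T k < T z then -(if T k < T z then
            ((Real.sin a / √r : ℝ) : ℂ) else ((Real.cos a / √(N - r) : ℝ) : ℂ))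
          else (if T k < T z then
            ((Real.sin a / √r : ℝ) : ℂ) else ((Real.cos a / √(N - r) : ℝ) : ℂ))) =
          ((-(r * (Real.sin a / √r)) + (N - r) * (Real.cos a / √(N - r)) : ℝ) : ℂ) := by
        have : ∀ k, (if T k < T z then -(if T k < T z then
            ((Real.sin a / √r : ℝ) : ℂ) else ((Real.cos a / √(N - r) : ℝ) : ℂ))
          else (if T k < T z then
            ((Real.sin a / √r : ℝ) : ℂ) else ((Real.cos a / √(N - r) : ℝ) : ℂ))) =
          ((if T k < T z then -(Real.sin a / √r) else Real.cos a / √(N - r) : ℝ) : ℂ) := by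
          intro k
          by_cases h : T k < T z <;> simp [h]
        rw [Finset.sum_congr rfl fun k _ => this k, ← Complex.ofReal_sum, Finset.sum_ite,
          Finset.sum_const, Finset.sum_const, nsmul_eq_mul, nsmul_eq_mul, hcard', hcard]
        congr 1
        ring
      rw [hsum]
      have hA : √r * √r = r := Real.mul_self_sqrt hr0.le
      have hB : √((N : ℝ) - r) * √((N : ℝ) - r) = N - r := Real.mul_self_sqrt hrN.le
      have hC : √(N : ℝ) * √(N : ℝ) = N := Real.mul_self_sqrt hN.le
      have hA0 := Real.sqrt_pos.2 hr0
      have hB0 := Real.sqrt_pos.2 hrN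
      have hC0 := Real.sqrt_pos.2 hN
      have hABC : √r * √r + √((N : ℝ) - r) * √((N : ℝ) - r) = √(N : ℝ) * √(N : ℝ) := by
        rw [hA, hB, hC]; ring
      have hcast : (2 / (N : ℂ)) = ((2 / (N : ℝ) : ℝ) : ℂ) := by push_cast; rfl
      rw [hcast]
      by_cases h : T i < T z
      · simp only [h, if_true, Real.sin_add, Real.sin_two_mul, Real.cos_two_mul', hs', hc']
        rw [← Complex.ofReal_mul, ← Complex.ofReal_neg, ← Complex.ofReal_sub]
        congr 1
        -- With the square roots as atoms, the addition formulas reduce to a rational identity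
        -- modulo `A² + B² = D²`.
        generalize √r = A at *
        generalize √((N : ℝ) - r) = B at *
        generalize √(N : ℝ) = D at *
        rw [← hB, ← hC, ← hA]
        field_simp
        linear_combination (-Real.sin a) * hABC
      · simp only [h, if_false, Real.cos_add, Real.sin_two_mul, Real.cos_two_mul', hs', hc']
        rw [← Complex.ofReal_mul, ← Complex.ofReal_sub]
        congr 1
        generalize √r = A at *
        generalize √((N : ℝ) - r) = B at *
        generalize √(N : ℝ) = D at *
        rw [← hB, ← hC, ← hA]
        field_simp
        linear_combination (Real.cos a) * hABC
    · simp [ih, hz]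

theorem outcomeProb_grover (y : Fin N) (hy : rank T y ≠ 0) (j : ℕ) (i : Fin N) :
    outcomeProb ((groverStep T)^[j] (initState y)) i =
      if T i < T y then
        Real.sin ((2 * j + 1) * groverAngle N (rank T y)) ^ 2 / rank T y
      else
        Real.cos ((2 * j + 1) * groverAngle N (rank T y)) ^ 2 / (N - rank T y) := by
  have hrN : 0 ≤ (N : ℝ) - rank T y := by
    rw [sub_nonneg]; exact_mod_cast (rank_lt T y).le
  rw [outcomeProb, Finset.sum_eq_single y]
  · rw [grover_amplitude T y hy, if_pos rfl]
    split_ifs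
    · rw [Complex.norm_real, Real.norm_eq_abs, sq_abs, div_pow, Real.sq_sqrt (by positivity)]
    · rw [Complex.norm_real, Real.norm_eq_abs, sq_abs, div_pow, Real.sq_sqrt hrN]
  · intro z _ hz
    rw [grover_amplitude T y hy, if_neg hz]
    simp
  · simp

/-- All marked items have equal probability, so a success averages `f` over all smaller ranks; a
failure contributes the constant `K`. -/
theorem sum_outcomeProb_grover {T : Fin N → α} (hT : Function.Injective T) (y : Fin N)
    (hy : rank T y ≠ 0) (j : ℕ) (f : ℕ → ℝ) (K : ℝ) :
    ∑ i, outcomeProb ((groverStep T)^[j] (initState y)) i *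
        (if T i < T y then f (rank T i) else K) =
      Real.sin ((2 * j + 1) * groverAngle N (rank T y)) ^ 2 *
          ((∑ k ∈ Finset.range (rank T y), f k) / rank T y) +
        Real.cos ((2 * j + 1) * groverAngle N (rank T y)) ^ 2 * K := by
  have hrN : 0 < (N : ℝ) - rank T y := by
    rw [sub_pos]; exact_mod_cast rank_lt T y
  have hcard := card_filter_not_lt T y
  simp only [outcomeProb_grover T y hy]
  rw [← Finset.sum_filter_add_sum_filter_not Finset.univ (fun i => T i < T y)]
  congr 1
  · rw [← sum_rank_lt hT, Finset.sum_div, Finset.mul_sum]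
    refine Finset.sum_congr rfl fun i hi => ?_
    rw [if_pos (Finset.mem_filter.1 hi).2, if_pos (Finset.mem_filter.1 hi).2]
    ring
  · rw [Finset.sum_congr rfl fun i hi => by
      rw [if_neg (Finset.mem_filter.1 hi).2, if_neg (Finset.mem_filter.1 hi).2],
      Finset.sum_const, nsmul_eq_mul, hcard]
    field_simp

end Grover

/-! ### The success probability of a round of the exponential search -/

/-- Telescoping: the term at `j`, multiplied by `sin 2θ`, is half the difference of `sin (4(j+1)θ)`
and `sin (4jθ)`. -/
theorem sin_two_mul_mul_sum_cos (θ : ℝ) (M : ℕ) :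
    Real.sin (2 * θ) * ∑ j ∈ Finset.range M, Real.cos (2 * ((2 * j + 1) * θ)) =
      Real.sin (4 * M * θ) / 2 := by
  induction M with
  | zero => simp
  | succ M ih =>
    rw [Finset.sum_range_succ, mul_add, ih]
    have h1 : (4 * ((M + 1 : ℕ) : ℝ) * θ) = 2 * ((2 * M + 1) * θ) + 2 * θ := by push_cast; ring
    have h2 : 4 * (M : ℝ) * θ = 2 * ((2 * M + 1) * θ) - 2 * θ := by ring
    rw [h1, h2, Real.sin_add, Real.sin_sub]
    ring

theorem sum_cos_sq_le_of_sin_le {θ : ℝ} {M : ℕ} (hθ : 0 < Real.sin (2 * θ))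
    (h : Real.sin (4 * M * θ) ≤ M * Real.sin (2 * θ)) :
    ∑ j ∈ Finset.range M, Real.cos ((2 * j + 1) * θ) ^ 2 ≤ 3 / 4 * M := by
  have key := sin_two_mul_mul_sum_cos θ M
  simp only [Real.cos_sq, Finset.sum_add_distrib, ← Finset.sum_div, Finset.sum_const,
    Finset.card_range, nsmul_eq_mul]
  have : ∑ j ∈ Finset.range M, Real.cos (2 * ((2 * j + 1) * θ)) ≤ M / 2 := by
    refine le_of_mul_le_mul_left ?_ hθ
    rw [key]
    linarith
  linarith

theorem sum_cos_sq_le (θ : ℝ) (M : ℕ) :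
    ∑ j ∈ Finset.range M, Real.cos ((2 * j + 1) * θ) ^ 2 ≤ M := by
  refine (Finset.sum_le_sum fun j _ => Real.cos_sq_le_one _).trans ?_
  simp

/-- The critical value of the parameter of the exponential search with `t` marked items. -/
def criticalBound (N t : ℕ) : ℝ := √(N / (3 * t) : ℝ)

/-- From the critical value on, a round succeeds with probability at least `1/4`. -/
theorem sum_cos_sq_groverAngle_le {N t M : ℕ} (ht : 0 < t) (htN : t < N) (hM : 0 < M)
    (h : criticalBound N t ≤ M) :
    ∑ j ∈ Finset.range M, Real.cos ((2 * j + 1) * groverAngle N t) ^ 2 ≤ 3 / 4 * M := by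
  have hs := sin_groverAngle htN
  have hc := cos_groverAngle (N := N) t
  have hθ0 : 0 ≤ groverAngle N t := Real.arcsin_nonneg.2 (Real.sqrt_nonneg _)
  have hθ1 : groverAngle N t ≤ Real.pi / 2 := Real.arcsin_le_pi_div_two _
  have ht' : (0 : ℝ) < t := by exact_mod_cast ht
  have htN' : (t : ℝ) < N := by exact_mod_cast htN
  have hN : (0 : ℝ) < N := ht'.trans htN'
  have hM' : (1 : ℝ) ≤ M := by exact_mod_cast hM
  set p : ℝ := (t : ℝ) / N with hp
  have hp0 : 0 < p := by positivity
  have hp1 : p < 1 := (div_lt_one hN).2 htN'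
  set θ := groverAngle N t
  have hs0 : 0 < Real.sin θ := by rw [hs]; exact Real.sqrt_pos.2 hp0
  have hc0 : 0 < Real.cos θ := by rw [hc]; exact Real.sqrt_pos.2 (by linarith)
  have hs2 : Real.sin θ ^ 2 = p := by rw [hs, Real.sq_sqrt hp0.le]
  have hc2 : Real.cos θ ^ 2 = 1 - p := by rw [hc, Real.sq_sqrt (by linarith)]
  have hd0 : 0 < Real.sin (2 * θ) := by rw [Real.sin_two_mul]; positivity
  have hd2 : Real.sin (2 * θ) ^ 2 = 4 * p * (1 - p) := by
    rw [Real.sin_two_mul, mul_pow, mul_pow, hs2, hc2]; ring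
  -- The critical bound squared, in terms of the marked fraction `p`.
  have hM2 : 1 ≤ 3 * p * (M : ℝ) ^ 2 := by
    have h1 : (N : ℝ) / (3 * t) ≤ (M : ℝ) ^ 2 := (Real.sqrt_le_left (by positivity)).1 h
    have h2 : (N : ℝ) / (3 * t) * (3 * p) = 1 := by rw [hp]; field_simp
    nlinarith
  have of_one_le : 1 ≤ M * Real.sin (2 * θ) →
      ∑ j ∈ Finset.range M, Real.cos ((2 * j + 1) * θ) ^ 2 ≤ 3 / 4 * M := fun h1 =>
    sum_cos_sq_le_of_sin_le hd0 ((Real.sin_le_one _).trans h1)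
  have of_sq : 1 ≤ (M : ℝ) ^ 2 * (4 * p * (1 - p)) →
      ∑ j ∈ Finset.range M, Real.cos ((2 * j + 1) * θ) ^ 2 ≤ 3 / 4 * M := fun h1 => by
    refine of_one_le ?_
    rw [← hd2, ← mul_pow] at h1
    exact (one_le_sq_iff₀ (by positivity)).1 h1
  -- Few marked items: `4p(1 - p) ≥ 3p`, so `M sin 2θ ≥ 1`.
  rcases le_total p (1 / 4) with h4 | h4
  · refine of_sq (hM2.trans ?_)
    nlinarith [mul_nonneg (mul_nonneg hp0.le (sq_nonneg (M : ℝ))) (by linarith : 0 ≤ 1 / 4 - p)]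
  -- Middle range: for `M = 1` the failure probability is `1 - p ≤ 3/4` directly; for `M ≥ 2`, `4p(1
  -- - p) ≥ 3/4` suffices.
  rcases le_total p (3 / 4) with h34 | h34
  · rcases Nat.lt_or_ge M 2 with hM1 | hM1
    · obtain rfl : M = 1 := by omega
      simp [hc2]
      linarith
    · have hM2' : (2 : ℝ) ≤ M := by exact_mod_cast hM1
      refine of_sq ?_
      have : 3 / 4 ≤ 4 * p * (1 - p) := by nlinarith
      nlinarith
  -- Mostly marked items: `sin 2θ` may be tiny, so the angle is reflected to `x = π - 2θ`. Either
  -- `2Mx ≤ π` and `sin (4Mθ) = -sin (2Mx) ≤ 0`, or Jordan's inequality gives `M sin x ≥ 2Mx / π ≥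
  -- 1`.
  · have hθ : Real.pi / 4 ≤ θ := by
      by_contra hlt
      push Not at hlt
      have h1 : Real.cos (2 * θ) < 0 := by
        rw [Real.cos_two_mul, hc2]; linarith
      exact absurd (Real.cos_nonneg_of_neg_pi_div_two_le_of_le (x := 2 * θ)
        (by linarith [Real.pi_pos]) (by linarith)) (not_le.2 h1)
    set x := Real.pi - 2 * θ with hx
    have hx0 : 0 ≤ x := by linarith
    have hx1 : x ≤ Real.pi / 2 := by linarith
    have hsx : Real.sin (2 * θ) = Real.sin x := by rw [hx, Real.sin_pi_sub]
    have hsin : Real.sin (4 * M * θ) = - Real.sin (2 * M * x) := by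
      have : 2 * M * x = ((M : ℕ) : ℝ) * (2 * Real.pi) - 4 * M * θ := by rw [hx]; ring
      rw [this, Real.sin_nat_mul_two_pi_sub, neg_neg]
    rcases le_total (2 * M * x) Real.pi with hπ | hπ
    · refine sum_cos_sq_le_of_sin_le hd0 ?_
      have := Real.sin_nonneg_of_nonneg_of_le_pi (by positivity : 0 ≤ 2 * M * x) hπ
      rw [hsin]
      have : 0 ≤ M * Real.sin (2 * θ) := by positivity
      linarith
    · refine of_one_le ?_
      have hj := Real.mul_le_sin hx0 hx1
      rw [hsx]
      have : 1 ≤ M * (2 / Real.pi * x) := by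
        rw [show M * (2 / Real.pi * x) = 2 * M * x / Real.pi by ring, one_le_div Real.pi_pos]
        exact hπ
      nlinarith

/-! ### Cost of the exponential search -/

theorem criticalBound_le {N t : ℕ} (ht : 0 < t) : criticalBound N t ≤ √(N : ℝ) := by
  refine Real.sqrt_le_sqrt ?_
  have : (1 : ℝ) ≤ t := by exact_mod_cast ht
  exact div_le_self (by positivity) (by linarith)

/-- A bound on the expected number of Grover iterations of the exponential search with `t` marked
items, from round `s` on. -/
def roundCost (N t s : ℕ) : ℝ :=
  if criticalBound N t ≤ roundBound N s then 5 * roundBound N s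
  else 9 * criticalBound N t - 5 / 2 * roundBound N s

theorem roundCost_nonneg {N t : ℕ} (hN : 0 < N) (s : ℕ) : 0 ≤ roundCost N t s := by
  have := roundBound_pos hN s
  rw [roundCost]
  split_ifs with h <;> linarith

/-- The constants solve the recursion for the cost. Past the critical value, `a = 1/2 + 3/4 * 6/5 *
a` gives `a = 5`. Before it, failure is taken as certain, and the slope `-b` with `b = 1/2 + ... `
reduces to `b / 5 = 1/2`, so `b = 5/2`. -/
theorem roundCost_succ_le {N t : ℕ} (hN : 0 < N) (ht : 0 < t) (s : ℕ) {f : ℝ}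
    (hf1 : f ≤ 1) (hf : criticalBound N t ≤ roundBound N s → f ≤ 3 / 4) :
    roundBound N s / 2 + f * roundCost N t (s + 1) ≤ roundCost N t s := by
  have hV := roundCost_nonneg (t := t) hN (s + 1)
  have hm := roundBound_pos hN s
  have hm1 : roundBound N (s + 1) ≤ 6 / 5 * roundBound N s := min_le_left _ _
  have hcN := criticalBound_le (N := N) ht
  by_cases h : criticalBound N t ≤ roundBound N s
  · have h1 : criticalBound N t ≤ roundBound N (s + 1) :=
      le_min (by linarith) hcN
    have h2 : f * roundCost N t (s + 1) ≤ 3 / 4 * roundCost N t (s + 1) :=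
      mul_le_mul_of_nonneg_right (hf h) hV
    rw [roundCost, if_pos h1] at h2 ⊢
    rw [roundCost, if_pos h]
    linarith
  · have h2 : f * roundCost N t (s + 1) ≤ roundCost N t (s + 1) := mul_le_of_le_one_left hV hf1
    have h3 : roundCost N t s = 9 * criticalBound N t - 5 / 2 * roundBound N s := if_neg h
    rw [h3]
    refine (add_le_add_right h2 _).trans ?_
    -- The round that crosses the critical value `c` fixes the coefficient 9: with `m < c`, `m/2 + 5
    -- * (6/5 * m) + 5/2 * m = 9m ≤ 9c`.
    by_cases h1 : criticalBound N t ≤ roundBound N (s + 1)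
    · rw [roundCost, if_pos h1]
      linarith
    · rw [roundCost, if_neg h1]
      have : roundBound N (s + 1) = 6 / 5 * roundBound N s := by
        -- The cap `√N` is inactive here: it would put the next parameter at or above the critical
        -- value.
        refine min_eq_left (le_of_not_gt fun hlt => h1 ?_)
        rw [roundBound, min_eq_right hlt.le]
        exact hcN
      linarith

/-- A bound on the expected time of one search with `t` marked items. -/
def searchCost (N t : ℕ) : ℝ := Real.logb 2 N + 21 / 4 * √(N / t : ℝ)

theorem logb_add_roundCost_zero_le {N t : ℕ} (ht : 0 < t) (htN : t < N) :
    Real.logb 2 N + roundCost N t 0 ≤ searchCost N t := by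
  have ht' : (0 : ℝ) < t := by exact_mod_cast ht
  have htN' : (t : ℝ) ≤ N := by exact_mod_cast htN.le
  have hD : 1 ≤ √(N / t : ℝ) := Real.one_le_sqrt.2 ((one_le_div ht').2 htN')
  have hcrit : criticalBound N t = √(N / t : ℝ) / √3 := by
    rw [criticalBound, ← Real.sqrt_div (by positivity)]
    congr 1
    field_simp
  -- This yields the constant of `searchCost`: `9 * 7/12 = 21/4`, which also exceeds the 5 of the
  -- other case.
  have h3 : (12 / 7 : ℝ) ≤ √3 := Real.le_sqrt_of_sq_le (by norm_num)
  have : criticalBound N t ≤ 7 / 12 * √(N / t : ℝ) := by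
    rw [hcrit, div_le_iff₀ (by positivity)]
    nlinarith
  have h0 : roundBound N 0 = 1 := rfl
  by_cases h : criticalBound N t ≤ roundBound N 0
  · rw [searchCost, roundCost, if_pos h]
    linarith
  · rw [searchCost, roundCost, if_neg h]
    linarith

theorem logb_two_nonneg {N : ℕ} (hN : 0 < N) : 0 ≤ Real.logb 2 N :=
  Real.logb_nonneg (by norm_num) (by exact_mod_cast hN)

theorem searchCost_nonneg {N : ℕ} (hN : 0 < N) (t : ℕ) : 0 ≤ searchCost N t := by
  have := logb_two_nonneg hN
  rw [searchCost]
  positivity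

/-- The average of `indexCost N i` over `i < t`. -/
def averageCost (N t : ℕ) : ℝ := ∑ i ∈ Finset.Ico 1 t, searchCost N i / (i + 1)

/-- A bound on the expected time until the threshold is the minimum, starting from a threshold
of rank `t`. -/
def indexCost (N t : ℕ) : ℝ := if t = 0 then 0 else searchCost N t + averageCost N t

theorem averageCost_nonneg {N : ℕ} (hN : 0 < N) (t : ℕ) : 0 ≤ averageCost N t :=
  Finset.sum_nonneg fun i _ => div_nonneg (searchCost_nonneg hN i) (by positivity)

theorem indexCost_nonneg {N : ℕ} (hN : 0 < N) (t : ℕ) : 0 ≤ indexCost N t := by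
  rw [indexCost]
  split_ifs
  · exact le_rfl
  · exact add_nonneg (searchCost_nonneg hN t) (averageCost_nonneg hN t)

/-- This is the recursion for a uniform drop in rank: adding index `t` turns `t * A` into `(t + 1) *
A + searchCost N t`, where `A` is the average so far. Division by `t + 1` produces the weights of
`averageCost`. -/
theorem sum_indexCost (N t : ℕ) :
    ∑ k ∈ Finset.range t, indexCost N k = t * averageCost N t := by
  induction t with
  | zero => simp
  | succ t ih =>
    rw [Finset.sum_range_succ, ih]
    rcases Nat.eq_zero_or_pos t with rfl | ht
    · simp [indexCost, averageCost]
    · rw [indexCost, if_neg ht.ne', averageCost, averageCost, Finset.sum_Ico_succ_top ht]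
      push_cast
      field_simp
      ring

theorem sum_one_div_succ_le (N : ℕ) (hN : 0 < N) :
    ∑ i ∈ Finset.Ico 1 N, (1 / (i + 1) : ℝ) ≤ Real.log N := by
  induction N, hN using Nat.le_induction with
  | base => simp
  | succ n hn ih =>
    rw [Finset.sum_Ico_succ_top hn]
    have hn' : (0 : ℝ) < n := by exact_mod_cast hn
    have h := Real.log_le_sub_one_of_pos (x := n / (n + 1)) (by positivity)
    rw [Real.log_div (by positivity) (by positivity)] at h
    have : (n : ℝ) / (n + 1) - 1 = -(1 / (n + 1)) := by field_simp; ring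
    push_cast
    linarith

/-- Each term is at most the telescoping difference `2/√i - 2/√(i+1)`. -/
theorem sum_one_div_succ_mul_sqrt_le (N : ℕ) (hN : 0 < N) :
    ∑ i ∈ Finset.Ico 1 N, (1 / ((i + 1) * √(i : ℝ)) : ℝ) ≤ 2 - 2 / √(N : ℝ) := by
  induction N, hN using Nat.le_induction with
  | base => simp
  | succ n hn ih =>
    rw [Finset.sum_Ico_succ_top hn]
    refine (add_le_add_left ih _).trans ?_
    have hn' : (0 : ℝ) < n := by exact_mod_cast hn
    push_cast
    have ha := Real.sqrt_pos.2 hn'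
    have hb : 0 < √((n : ℝ) + 1) := Real.sqrt_pos.2 (by positivity)
    have hab : √(n : ℝ) ≤ √((n : ℝ) + 1) := Real.sqrt_le_sqrt (by linarith)
    have ha2 : √(n : ℝ) * √(n : ℝ) = n := Real.mul_self_sqrt hn'.le
    have hb2 : √((n : ℝ) + 1) * √((n : ℝ) + 1) = n + 1 := Real.mul_self_sqrt (by positivity)
    generalize √(n : ℝ) = a at *
    generalize √((n : ℝ) + 1) = b at *
    rw [← hb2]
    have : 1 / (b * b * a) ≤ 2 / a - 2 / b := by
      rw [div_sub_div _ _ ha.ne' hb.ne', div_le_div_iff₀ (by positivity) (by positivity)]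
      -- Since `(b + a)(b - a) = 1` and `a ≤ b`.
      have : 1 ≤ 2 * b * (b - a) := by nlinarith
      nlinarith [mul_pos ha hb]
    linarith

/-- The two sums are at most `log N` and 2. With `log 2 < 7/10` the result is at most `7/10 * lg² N
+ 21/2 * √N`, while half the limit has `11.25 * √N`. -/
theorem averageCost_le (N : ℕ) (hN : 0 < N) : averageCost N N ≤ timeLimit N / 2 := by
  have h1 := sum_one_div_succ_le N hN
  have h2 := sum_one_div_succ_mul_sqrt_le N hN
  have hl := logb_two_nonneg hN
  have hsum : averageCost N N =
      Real.logb 2 N * ∑ i ∈ Finset.Ico 1 N, (1 / (i + 1) : ℝ) +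
        21 / 4 * √(N : ℝ) * ∑ i ∈ Finset.Ico 1 N, (1 / ((i + 1) * √(i : ℝ)) : ℝ) := by
    rw [averageCost, Finset.mul_sum, Finset.mul_sum, ← Finset.sum_add_distrib]
    refine Finset.sum_congr rfl fun i hi => ?_
    have : (0 : ℝ) < i := by exact_mod_cast (Finset.mem_Ico.1 hi).1
    have := Real.sqrt_pos.2 this
    rw [searchCost, Real.sqrt_div (by positivity)]
    field_simp
  have hlog : Real.log N ≤ 7 / 10 * Real.logb 2 N := by
    have h3 : Real.log N = Real.log 2 * Real.logb 2 N := by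
      rw [Real.logb, mul_div_cancel₀ _ (Real.log_pos (by norm_num)).ne']
    rw [h3]
    exact mul_le_mul_of_nonneg_right (by linarith [Real.log_two_lt_d9]) hl
  have hs0 : 0 < √(N : ℝ) := Real.sqrt_pos.2 (by exact_mod_cast hN)
  have h2' : ∑ i ∈ Finset.Ico 1 N, (1 / ((i + 1) * √(i : ℝ)) : ℝ) ≤ 2 :=
    h2.trans (by linarith [div_pos (two_pos (α := ℝ)) hs0])
  rw [hsum, timeLimit]
  have h4 := mul_le_mul_of_nonneg_left (h1.trans hlog) hl
  have h5 := mul_le_mul_of_nonneg_left h2' (by positivity : 0 ≤ 21 / 4 * √(N : ℝ))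
  nlinarith

theorem timeLimit_add_logb_le {N : ℕ} (hN : 0 < N) :
    timeLimit N + Real.logb 2 N ≤ 200 * √(N : ℝ) := by
  have hN' : (1 : ℝ) ≤ N := by exact_mod_cast hN
  have hs : 1 ≤ √(N : ℝ) := Real.one_le_sqrt.2 hN'
  have hq : 1 ≤ √√(N : ℝ) := Real.one_le_sqrt.2 hs
  have hq2 : √√(N : ℝ) ^ 2 = √(N : ℝ) := Real.sq_sqrt (by positivity)
  have hlog : Real.log N = 4 * Real.log √√(N : ℝ) := by
    rw [Real.log_sqrt (by positivity), Real.log_sqrt (by positivity)]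
    ring
  have hlog' : Real.log √√(N : ℝ) ≤ √√(N : ℝ) - 1 := Real.log_le_sub_one_of_pos (by linarith)
  have hl0 := logb_two_nonneg hN
  -- Comparing with the fourth root of `N` makes even `lg² N` of order `√N`.
  have hl : Real.logb 2 N ≤ 8 * √√(N : ℝ) := by
    rw [Real.logb, div_le_iff₀ (Real.log_pos (by norm_num)), hlog]
    nlinarith [Real.log_two_gt_d9]
  have hl2 : Real.logb 2 N ^ 2 ≤ 64 * √(N : ℝ) := by
    rw [← hq2]
    nlinarith
  rw [timeLimit]
  nlinarith

/-! ### The time until the threshold is the minimum -/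

section Chain

variable {N : ℕ} {α : Type*} [LinearOrder α] (T : Fin N → α)

/-- A bound on the expected remaining time until the threshold is the minimum, for an algorithm
that is not interrupted. -/
def remainingTime (y : Fin N) : Stage N → ℝ
  | .prepare => indexCost N (rank T y)
  | .round s => roundCost N (rank T y) s + averageCost N (rank T y)
  | .grover s j ψ => j + ∑ i, outcomeProb ((groverStep T)^[j] ψ) i *
      (if T i < T y then indexCost N (rank T i)
        else roundCost N (rank T y) (s + 1) + averageCost N (rank T y))
  | .observe ψ => ∑ i, outcomeProb ψ i * indexCost N (rank T (if T i < T y then i else y))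
  | .halted => 0

/-- A supermartingale which is at least `timeLimit N` when the algorithm has halted with a
threshold that is not the minimum. -/
def lateness : Config N → ℝ≥0∞
  | ⟨.halted, y, _, _⟩ => if rank T y = 0 then 0 else ENNReal.ofReal (timeLimit N)
  | ⟨.observe ψ, y, t, _⟩ => if rank T y = 0 then 0 else
      ENNReal.ofReal t +
        if timeLimit N < t then 0 else ENNReal.ofReal (remainingTime T y (.observe ψ))
  | ⟨st, y, t, _⟩ => if rank T y = 0 then 0 else
      ENNReal.ofReal t + ENNReal.ofReal (remainingTime T y st)

theorem lateness_le {st : Stage N} (hst : st ≠ .halted) (y : Fin N) (t : ℝ) (q : ℕ) :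
    lateness T ⟨st, y, t, q⟩ ≤ ENNReal.ofReal t + ENNReal.ofReal (remainingTime T y st) := by
  cases st <;> simp only [lateness] <;> split_ifs <;> simp_all

theorem lateness_observe_le {ψ : QState N} {y : Fin N} {t : ℝ} (q : ℕ) (ht : timeLimit N < t) :
    lateness T ⟨.observe ψ, y, t, q⟩ ≤ ENNReal.ofReal t := by
  simp only [lateness]
  split_ifs <;> simp

theorem lateness_eq_zero {c : Config N} (h : rank T c.threshold = 0) : lateness T c = 0 := by
  obtain ⟨st, y, t, q⟩ := c
  cases st <;> simp_all [lateness]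

theorem threshold_eq_of_mem_support_step {c d : Config N} (h : rank T c.threshold = 0)
    (hd : d ∈ (step T c).support) : d.threshold = c.threshold := by
  rw [rank_eq_zero_iff] at h
  obtain ⟨st, y, t, q⟩ := c
  cases st with
  | prepare => simp only [step, PMF.support_pure, Set.mem_singleton_iff] at hd; rw [hd]
  | round s =>
    simp only [step, PMF.mem_support_bind_iff, PMF.support_pure, Set.mem_singleton_iff] at hd
    obtain ⟨_, -, rfl⟩ := hd
    rfl
  | grover s j ψ =>
    cases j with
    | zero =>
      simp only [step, PMF.mem_support_bind_iff, PMF.support_pure, Set.mem_singleton_iff] at hd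
      obtain ⟨_, -, rfl⟩ := hd
      rfl
    | succ j => simp only [step, PMF.support_pure, Set.mem_singleton_iff] at hd; rw [hd]
  | observe ψ =>
    simp only [step, PMF.mem_support_bind_iff, PMF.support_pure, Set.mem_singleton_iff] at hd
    obtain ⟨i, -, rfl⟩ := hd
    exact if_neg (not_lt.2 (h i))
  | halted => simp only [step, PMF.support_pure, Set.mem_singleton_iff] at hd; rw [hd]

theorem remainingTime_prepare {y : Fin N} (hy : rank T y ≠ 0) :
    Real.logb 2 N + remainingTime T y (.round 0) ≤ remainingTime T y .prepare := by
  have := logb_add_roundCost_zero_le (Nat.pos_of_ne_zero hy) (rank_lt T y)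
  simp only [remainingTime, indexCost, if_neg hy]
  linarith

theorem remainingTime_nonneg (y : Fin N) (st : Stage N) : 0 ≤ remainingTime T y st := by
  have hN := y.pos
  cases st with
  | prepare => exact indexCost_nonneg hN _
  | round s => exact add_nonneg (roundCost_nonneg hN s) (averageCost_nonneg hN _)
  | grover s j ψ =>
    refine add_nonneg (by positivity) (Finset.sum_nonneg fun i _ =>
      mul_nonneg (outcomeProb_nonneg _ _) ?_)
    split_ifs
    · exact indexCost_nonneg hN _
    · exact add_nonneg (roundCost_nonneg hN _) (averageCost_nonneg hN _)
  | observe ψ =>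
    exact Finset.sum_nonneg fun i _ => mul_nonneg (outcomeProb_nonneg _ _) (indexCost_nonneg hN _)
  | halted => exact le_rfl

theorem remainingTime_observe_basisState {i y : Fin N} (h : T i < T y) :
    remainingTime T y (.observe (basisState i y)) = indexCost N (rank T i) := by
  simp [remainingTime, outcomeProb_basisState, h]

variable {T}

/-- A uniform `j < M` costs `(M - 1)/2 ≤ m/2` iterations on average because `M = ⌈m⌉`. Success and
failure both carry the average cost of the later thresholds, so only the cost of further rounds is
weighted by the failure probability. -/
theorem remainingTime_round (hT : Function.Injective T) {y : Fin N} (hy : rank T y ≠ 0) (s : ℕ) :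
    (∑ j ∈ Finset.range ⌈roundBound N s⌉₊, remainingTime T y (.grover s j (initState y))) /
      ⌈roundBound N s⌉₊ ≤ remainingTime T y (.round s) := by
  have hN := y.pos
  have hr := Nat.pos_of_ne_zero hy
  have hr' : (rank T y : ℝ) ≠ 0 := by exact_mod_cast hy
  have hm := roundBound_pos hN s
  have hM : 0 < ⌈roundBound N s⌉₊ := Nat.ceil_pos.2 hm
  have hMm := (Nat.ceil_lt_add_one hm.le).le
  have hmM := Nat.le_ceil (roundBound N s)
  set M := ⌈roundBound N s⌉₊
  have hM' : (0 : ℝ) < M := by exact_mod_cast hM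
  set F := ∑ j ∈ Finset.range M, Real.cos ((2 * j + 1) * groverAngle N (rank T y)) ^ 2
  have hF : F / M ≤ 1 := (div_le_one hM').2 (sum_cos_sq_le _ _)
  have hF' : criticalBound N (rank T y) ≤ roundBound N s → F / M ≤ 3 / 4 := fun h =>
    (div_le_iff₀ hM').2 (sum_cos_sq_groverAngle_le hr (rank_lt T y) hM (h.trans hmM))
  have hV := roundCost_succ_le hN hr s hF hF'
  have hgauss : ∑ j ∈ Finset.range M, (j : ℝ) = M * (M - 1) / 2 := by
    clear_value M
    clear * -
    induction M with
    | zero => simp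
    | succ n ih => rw [Finset.sum_range_succ, ih]; push_cast; ring
  have hterm : ∀ j : ℕ, remainingTime T y (.grover s j (initState y)) =
      j + averageCost N (rank T y) +
        Real.cos ((2 * j + 1) * groverAngle N (rank T y)) ^ 2 *
          roundCost N (rank T y) (s + 1) := by
    intro j
    rw [remainingTime, sum_outcomeProb_grover hT y hy, sum_indexCost, Real.sin_sq,
      mul_div_cancel_left₀ _ hr']
    ring
  rw [Finset.sum_congr rfl fun j _ => hterm j, Finset.sum_add_distrib, Finset.sum_add_distrib,
    ← Finset.sum_mul, hgauss, Finset.sum_const, Finset.card_range, nsmul_eq_mul]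
  have : (M * ((M : ℝ) - 1) / 2 + M * averageCost N (rank T y) +
      F * roundCost N (rank T y) (s + 1)) / M =
      (M - 1) / 2 + averageCost N (rank T y) + F / M * roundCost N (rank T y) (s + 1) := by
    field_simp
  rw [this, remainingTime]
  linarith

theorem mean_add_ofReal_observeFirst (ψ : QState N) (a : ℝ≥0∞) {f : Fin N → ℝ}
    (hf : ∀ i, 0 ≤ f i) :
    mean (observeFirst ψ) (fun i => a + ENNReal.ofReal (f i)) =
      a + ENNReal.ofReal (∑ i, outcomeProb ψ i * f i) := by
  rw [mean_add, mean_const, mean_observeFirst ψ hf]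

/-- Every step moves expected time from remaining to elapsed. Once the limit is passed, the
remaining time is dropped, since only the final observation is left; halting then lowers the value
from `t` to the limit, or to zero at the minimum. -/
theorem mean_step_lateness_le (hT : Function.Injective T) (c : Config N) :
    mean (step T c) (lateness T) ≤ lateness T c := by
  by_cases hy : rank T c.threshold = 0
  · rw [lateness_eq_zero T hy]
    refine mean_le_of_forall fun d hd => (lateness_eq_zero T ?_).le
    rwa [threshold_eq_of_mem_support_step T hy hd]
  obtain ⟨st, y, t, q⟩ := c
  have hN := y.pos
  change rank T y ≠ 0 at hy
  cases st with
  | prepare =>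
    simp only [step, mean_pure]
    have hp := remainingTime_prepare T hy
    have hl := logb_two_nonneg hN
    simp only [lateness, if_neg hy]
    split_ifs with h
    · refine (lateness_observe_le T (q + 1) h).trans (ENNReal.ofReal_add_le.trans ?_)
      refine add_le_add le_rfl (ENNReal.ofReal_le_ofReal ?_)
      linarith [remainingTime_nonneg T y (.round 0)]
    · refine (lateness_le T (st := .round 0) (by simp) y _ (q + 1)).trans
        ((add_le_add ENNReal.ofReal_add_le le_rfl).trans ?_)
      rw [add_assoc, ← ENNReal.ofReal_add hl (remainingTime_nonneg T _ _)]
      exact add_le_add le_rfl (ENNReal.ofReal_le_ofReal hp)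
  | round s =>
    simp only [step, mean_bind, mean_pure, lateness, if_neg hy]
    rw [mean_add, mean_const, chooseIterations, mean_uniformOfFinset _ _ fun j =>
      remainingTime_nonneg T _ _, Finset.card_range]
    exact add_le_add le_rfl (ENNReal.ofReal_le_ofReal (remainingTime_round hT hy s))
  | grover s j ψ =>
    cases j with
    | zero =>
      simp only [step, mean_bind, mean_pure]
      simp only [lateness, if_neg hy, remainingTime, Nat.cast_zero, zero_add,
        Function.iterate_zero, id]
      rw [← mean_add_ofReal_observeFirst]
      · refine mean_mono fun i => ?_
        split_ifs with h
        · refine (lateness_le T (st := .observe (basisState i y)) (by simp) y t (q + 1)).trans ?_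
          rw [remainingTime_observe_basisState T h]
        · exact lateness_le T (st := .round (s + 1)) (by simp) y t (q + 1)
      · intro i
        split_ifs
        · exact indexCost_nonneg hN _
        · exact add_nonneg (roundCost_nonneg hN _) (averageCost_nonneg hN _)
    | succ j =>
      simp only [step, mean_pure]
      have hrem : remainingTime T y (.grover s (j + 1) ψ) =
          1 + remainingTime T y (.grover s j (groverStep T ψ)) := by
        simp only [remainingTime, Function.iterate_succ_apply]
        push_cast
        ring
      have h0 := remainingTime_nonneg T y (.grover s j (groverStep T ψ))
      simp only [lateness, if_neg hy, hrem]
      rw [ENNReal.ofReal_add zero_le_one h0, ← add_assoc]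
      split_ifs with h
      · exact (lateness_observe_le T (q + 1) h).trans (ENNReal.ofReal_add_le.trans le_self_add)
      · exact (lateness_le T (st := .grover s j (groverStep T ψ)) (by simp) y _ (q + 1)).trans
          (add_le_add ENNReal.ofReal_add_le le_rfl)
  | observe ψ =>
    have hW : lateness T ⟨.observe ψ, y, t, q⟩ = ENNReal.ofReal t +
        if timeLimit N < t then 0 else ENNReal.ofReal (remainingTime T y (.observe ψ)) :=
      if_neg hy
    simp only [step, mean_bind, mean_pure]
    rw [hW]
    by_cases h : timeLimit N < t
    · simp only [if_pos h, add_zero]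
      refine mean_le_of_forall fun i _ => ?_
      have hL := ENNReal.ofReal_le_ofReal h.le
      simp only [lateness]
      split_ifs <;> first | exact zero_le | exact hL
    · simp only [if_neg h]
      rw [remainingTime, ← mean_add_ofReal_observeFirst _ _ fun i => indexCost_nonneg hN _]
      exact mean_mono fun i => lateness_le T (st := .prepare) (by simp) _ t (q + 1)
  | halted => simp only [step, mean_pure, le_refl]

/-! ### Reachable configurations -/

/-- The time of a configuration respects the limit, up to the step that exceeds it, and `n` steps
without halting take a number of probes proportional to `n`. -/
def IsReachable (n : ℕ) : Config N → Prop
  | ⟨.prepare, _, t, q⟩ => t ≤ timeLimit N ∧ n ≤ 2 * q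
  | ⟨.round _, _, t, q⟩ => t ≤ timeLimit N ∧ n ≤ 2 * q
  | ⟨.grover _ _ _, _, t, q⟩ => t ≤ timeLimit N ∧ n ≤ 2 * q + 1
  | ⟨.observe _, _, t, q⟩ => t ≤ timeLimit N + Real.logb 2 N ∧ n ≤ 2 * q
  | ⟨.halted, _, t, _⟩ => t ≤ timeLimit N + Real.logb 2 N

theorem one_le_logb_two (hN : 2 ≤ N) : 1 ≤ Real.logb 2 N := by
  rw [Real.le_logb_iff_rpow_le (by norm_num) (by positivity)]
  simpa using hN

/-- Before halting, the only step without a probe is the choice of `j`, and it is never repeated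
without a probe in between. A timed step lasts at most `lg N`, using `1 ≤ lg N`, which bounds the
overshoot. -/
theorem IsReachable.step (hN : 2 ≤ N) {n : ℕ} {c d : Config N} (hc : IsReachable n c)
    (hd : d ∈ (step T c).support) : IsReachable (n + 1) d := by
  have hl := one_le_logb_two hN
  obtain ⟨st, y, t, q⟩ := c
  cases st with
  | prepare =>
    simp only [QuantumMinimum.step, PMF.support_pure, Set.mem_singleton_iff] at hd
    rw [hd]
    simp only [IsReachable] at hc
    split_ifs with h <;> simp only [IsReachable] <;> constructor <;> linarith
  | round s =>
    simp only [QuantumMinimum.step, PMF.mem_support_bind_iff, PMF.support_pure,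
      Set.mem_singleton_iff] at hd
    obtain ⟨_, -, rfl⟩ := hd
    simp only [IsReachable] at hc ⊢
    constructor <;> linarith
  | grover s j ψ =>
    simp only [IsReachable] at hc
    cases j with
    | zero =>
      simp only [QuantumMinimum.step, PMF.mem_support_bind_iff, PMF.support_pure,
        Set.mem_singleton_iff] at hd
      obtain ⟨_, -, rfl⟩ := hd
      split_ifs with h <;> simp only [IsReachable] <;> constructor <;> linarith
    | succ j =>
      simp only [QuantumMinimum.step, PMF.support_pure, Set.mem_singleton_iff] at hd
      rw [hd]
      split_ifs with h <;> simp only [IsReachable] <;> constructor <;> linarith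
  | observe ψ =>
    simp only [QuantumMinimum.step, PMF.mem_support_bind_iff, PMF.support_pure,
      Set.mem_singleton_iff] at hd
    obtain ⟨i, -, rfl⟩ := hd
    simp only [IsReachable] at hc
    by_cases h : timeLimit N < t
    · simp only [if_pos h, IsReachable]
      linarith
    · simp only [if_neg h, IsReachable]
      constructor <;> linarith
  | halted =>
    simp only [QuantumMinimum.step, PMF.support_pure, Set.mem_singleton_iff] at hd
    rw [hd]
    exact hc

/-! ### The number of probes -/

/-- The probes that the current search is bound to need, except those paid for by the time left. -/
def pendingProbes : Stage N → ℝ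
  | .prepare => 0
  | .round 0 => 2
  | .round (_ + 1) => 1
  | .grover _ 0 _ => 2
  | .grover _ (_ + 1) _ => 0
  | .observe _ => 1
  | .halted => 0

theorem pendingProbes_nonneg (st : Stage N) : 0 ≤ pendingProbes st := by
  rcases st with _ | (_ | _) | ⟨_, (_ | _), _⟩ | _ | _ <;> simp [pendingProbes]

/-- A supermartingale that bounds the number of probes. -/
def probeBudget (c : Config N) : ℝ :=
  c.probes + 3 * (timeLimit N + Real.logb 2 N - c.time) + pendingProbes c.stage

theorem two_le_ceil_roundBound_succ (hN : 2 ≤ N) (s : ℕ) : 2 ≤ ⌈roundBound N (s + 1)⌉₊ := by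
  have h1 : ∀ s, 1 ≤ roundBound N s := by
    have hs : 1 ≤ √(N : ℝ) := Real.one_le_sqrt.2 (by exact_mod_cast (by omega : 1 ≤ N))
    intro s
    induction s with
    | zero => exact le_rfl
    | succ s ih => exact le_min (by linarith) hs
  have hs : 1 < √(N : ℝ) := by
    rw [Real.lt_sqrt zero_le_one]
    have : (2 : ℝ) ≤ N := by exact_mod_cast hN
    linarith
  have : 1 < roundBound N (s + 1) := lt_min (by linarith [h1 s]) hs
  exact Nat.lt_ceil.2 (by exact_mod_cast this)

/-- Only `j = 0` gives an observation that no elapsed time pays for. After the first round there are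
at least two choices of `j`, so its probability is at most `1/2` and its cost of 2 averages to at
most 1. -/
theorem average_pendingProbes_le (hN : 2 ≤ N) (s : ℕ) (ψ : QState N) :
    (∑ j ∈ Finset.range ⌈roundBound N s⌉₊, pendingProbes (.grover s j ψ)) /
      ⌈roundBound N s⌉₊ ≤ pendingProbes (.round s : Stage N) := by
  have hM : 0 < ⌈roundBound N s⌉₊ := Nat.ceil_pos.2 (roundBound_pos (by omega) s)
  have hM' : (1 : ℝ) ≤ ⌈roundBound N s⌉₊ := by exact_mod_cast hM
  have hsum : ∑ j ∈ Finset.range ⌈roundBound N s⌉₊, pendingProbes (.grover s j ψ) = 2 := by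
    rw [Finset.sum_eq_single_of_mem 0 (Finset.mem_range.2 hM)]
    · rfl
    · intro j _ hj
      obtain ⟨k, rfl⟩ := Nat.exists_eq_succ_of_ne_zero hj
      rfl
  rw [hsum, div_le_iff₀ (by linarith)]
  cases s with
  | zero => simp only [pendingProbes]; linarith
  | succ s =>
    have : (2 : ℝ) ≤ ⌈roundBound N (s + 1)⌉₊ := by exact_mod_cast two_le_ceil_roundBound_succ hN s
    simp only [pendingProbes]
    linarith

/-- The three probes credited to a timed step cover its own probe and up to two pending ones: a
comparison, and then either the final observation or the expected need of the next round. -/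
theorem mean_step_probeBudget_le (hN : 2 ≤ N) {n : ℕ} {c : Config N} (hc : IsReachable n c) :
    mean (step T c) (fun d => ENNReal.ofReal (probeBudget d)) ≤
      ENNReal.ofReal (probeBudget c) := by
  have hl := one_le_logb_two hN
  obtain ⟨st, y, t, q⟩ := c
  cases st with
  | prepare =>
    simp only [step, mean_pure]
    refine ENNReal.ofReal_le_ofReal ?_
    split_ifs <;> simp only [probeBudget, pendingProbes] <;> push_cast <;> linarith
  | round s =>
    simp only [step, mean_bind, mean_pure]
    simp only [IsReachable] at hc
    have h := average_pendingProbes_le hN s (initState y)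
    have hB : 0 ≤ (q : ℝ) + 3 * (timeLimit N + Real.logb 2 N - t) :=
      add_nonneg (Nat.cast_nonneg q) (by linarith)
    simp only [probeBudget, ENNReal.ofReal_add hB (pendingProbes_nonneg _)]
    rw [mean_add, mean_const, chooseIterations, mean_uniformOfFinset _ _ fun j =>
      pendingProbes_nonneg _, Finset.card_range]
    exact add_le_add le_rfl (ENNReal.ofReal_le_ofReal h)
  | grover s j ψ =>
    cases j with
    | zero =>
      simp only [step, mean_bind, mean_pure]
      refine mean_le_of_forall fun i _ => ENNReal.ofReal_le_ofReal ?_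
      split_ifs <;> simp only [probeBudget, pendingProbes] <;> push_cast <;> linarith
    | succ j =>
      simp only [step, mean_pure]
      refine ENNReal.ofReal_le_ofReal ?_
      cases j <;> split_ifs <;> simp only [probeBudget, pendingProbes] <;> push_cast <;> linarith
  | observe ψ =>
    simp only [step, mean_bind, mean_pure]
    refine mean_le_of_forall fun i _ => ENNReal.ofReal_le_ofReal ?_
    split_ifs <;> simp only [probeBudget, pendingProbes] <;> push_cast <;> linarith
  | halted => simp only [step, mean_pure, le_refl]

/-! ### Runs of the algorithm -/

variable [NeZero N]

theorem isReachable_of_mem_support_run (hN : 2 ≤ N) (n : ℕ) :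
    ∀ c ∈ (run T n).support, IsReachable n c := by
  induction n with
  | zero =>
    intro c hc
    simp only [run, PMF.mem_support_bind_iff, PMF.support_pure, Set.mem_singleton_iff] at hc
    obtain ⟨y, -, rfl⟩ := hc
    refine ⟨?_, by simp⟩
    rw [timeLimit]
    positivity
  | succ n ih =>
    intro d hd
    simp only [run, PMF.mem_support_bind_iff] at hd
    obtain ⟨c, hc, hd⟩ := hd
    exact (ih c hc).step hN hd

theorem mean_run_le {f : Config N → ℝ≥0∞}
    (h : ∀ n, ∀ c ∈ (run T n).support, mean (step T c) f ≤ f c) (n : ℕ) :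
    mean (run T n) f ≤ mean (run T 0) f := by
  induction n with
  | zero => exact le_rfl
  | succ n ih => exact (mean_bind _ _ _).trans_le ((mean_mono_on (h n)).trans ih)

/-- A uniform first threshold has a uniform rank below `N`, so the initial mean is controlled by
`averageCost N N`. -/
theorem mean_run_zero_lateness_le (hT : Function.Injective T) :
    mean (run T 0) (lateness T) ≤ ENNReal.ofReal (timeLimit N / 2) := by
  have hN : 0 < N := Nat.pos_of_ne_zero (NeZero.ne N)
  have hN' : (N : ℝ) ≠ 0 := by exact_mod_cast hN.ne'
  simp only [run, mean_bind, mean_pure]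
  refine (mean_mono (g := fun y => ENNReal.ofReal (indexCost N (rank T y))) fun y => ?_).trans ?_
  · refine (lateness_le T (by simp) _ _ _).trans ?_
    simp [remainingTime]
  · rw [PMF.uniformOfFintype, mean_uniformOfFinset _ _ fun y => indexCost_nonneg hN _,
      sum_rank hT, sum_indexCost, Finset.card_univ, Fintype.card_fin, mul_div_cancel_left₀ _ hN']
    exact ENNReal.ofReal_le_ofReal (averageCost_le N hN)

theorem timeLimit_pos : 0 < timeLimit N := by
  have : (0 : ℝ) < N := by exact_mod_cast Nat.pos_of_ne_zero (NeZero.ne N)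
  rw [timeLimit]
  positivity

theorem prob_halted_not_min_le (hT : Function.Injective T) (n : ℕ) :
    (run T n).toOuterMeasure {c | c.stage = .halted ∧ rank T c.threshold ≠ 0} ≤ 1 / 2 := by
  have hL := timeLimit_pos (N := N)
  have h1 := mul_toOuterMeasure_le_mean (run T n) (f := lateness T)
    (s := {c | c.stage = .halted ∧ rank T c.threshold ≠ 0}) (a := ENNReal.ofReal (timeLimit N)) (by
      rintro ⟨st, y, t, q⟩ - ⟨h, hr⟩
      cases h
      simp only [lateness, if_neg hr, le_refl])
  have h2 := h1.trans ((mean_run_le (fun _ c _ => mean_step_lateness_le hT c) n).trans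
    (mean_run_zero_lateness_le hT))
  rw [ENNReal.ofReal_div_of_pos two_pos, ENNReal.ofReal_ofNat, ← mul_one_div,
    ENNReal.mul_le_mul_iff_right (by simpa using hL) ENNReal.ofReal_ne_top] at h2
  exact h2

theorem time_le_of_mem_support_run (hN : 2 ≤ N) {n : ℕ} {c : Config N}
    (hc : c ∈ (run T n).support) : c.time ≤ timeLimit N + Real.logb 2 N := by
  have hr := isReachable_of_mem_support_run hN n c hc
  have hl := one_le_logb_two hN
  obtain ⟨st, y, t, q⟩ := c
  cases st <;> simp only [IsReachable] at hr ⊢ <;> linarith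

theorem mean_run_probes_le (hN : 2 ≤ N) (n : ℕ) :
    mean (run T n) (fun c => (c.probes : ℝ≥0∞)) ≤ ENNReal.ofReal (600 * √(N : ℝ)) := by
  have hB := timeLimit_add_logb_le (N := N) (by omega)
  refine (mean_mono_on (g := fun c => ENNReal.ofReal (probeBudget c)) fun c hc => ?_).trans
    ((mean_run_le (fun n c hc =>
      mean_step_probeBudget_le hN (isReachable_of_mem_support_run hN n c hc)) n).trans ?_)
  · rw [← ENNReal.ofReal_natCast]
    refine ENNReal.ofReal_le_ofReal ?_
    have ht := time_le_of_mem_support_run hN hc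
    have := pendingProbes_nonneg c.stage
    rw [probeBudget]
    linarith
  · simp only [run, mean_bind, mean_pure]
    refine mean_le_of_forall fun y _ => ENNReal.ofReal_le_ofReal ?_
    simp only [probeBudget, pendingProbes, Nat.cast_zero]
    linarith

theorem prob_not_halted_le (hN : 2 ≤ N) (n : ℕ) :
    (n : ℝ≥0∞) * (run T (2 * n)).toOuterMeasure {c | c.stage ≠ .halted} ≤
      ENNReal.ofReal (600 * √(N : ℝ)) := by
  refine (mul_toOuterMeasure_le_mean _ fun c hc hh => ?_).trans (mean_run_probes_le hN (2 * n))
  have hr := isReachable_of_mem_support_run hN _ c hc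
  have : n ≤ c.probes := by
    obtain ⟨st, y, t, q⟩ := c
    cases st <;> simp only [IsReachable] at hr ⊢
    all_goals first | omega | exact absurd rfl hh
  exact_mod_cast this

/-- Halted configurations are absorbing; monotonicity later permits exchanging the supremum over
steps with finite sums over indices. -/
theorem prob_halted_mono : Monotone fun n => fun y : Fin N =>
    (run T n).toOuterMeasure {c | c.stage = .halted ∧ c.threshold = y} := by
  refine monotone_nat_of_le_succ fun n y => ?_
  simp only [toOuterMeasure_eq_mean]
  rw [run, mean_bind]
  refine mean_mono fun c => ?_
  by_cases h : c.stage = .halted ∧ c.threshold = y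
  · obtain ⟨st, z, t, q⟩ := c
    obtain ⟨rfl, rfl⟩ := h
    simp only [step, mean_pure, le_refl]
  · simp [h]

theorem sum_prob_halted (n : ℕ) :
    ∑ y, (run T n).toOuterMeasure {c | c.stage = .halted ∧ c.threshold = y} =
      (run T n).toOuterMeasure {c | c.stage = .halted} := by
  simp only [toOuterMeasure_eq_mean, mean]
  rw [← Summable.tsum_finsetSum fun _ _ => ENNReal.summable]
  refine tsum_congr fun c => ?_
  rw [← Finset.mul_sum]
  congr 1
  by_cases h : c.stage = .halted
  · have hy : ∀ y, {c : Config N | c.stage = .halted ∧ c.threshold = y}.indicator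
        (fun _ => (1 : ℝ≥0∞)) c = if c.threshold = y then 1 else 0 := by
      intro y
      by_cases hc : c.threshold = y <;> simp [h, hc]
    simp [hy, h]
  · simp [h]

theorem sum_returnProb (hN : 2 ≤ N) : ∑ y, returnProb T y = 1 := by
  have h1 : ∑ y, returnProb T y = ⨆ n, (run T n).toOuterMeasure {c | c.stage = .halted} := by
    simp only [returnProb]
    rw [ENNReal.finsetSum_iSup_of_monotone fun y n m h => prob_halted_mono h y]
    exact iSup_congr sum_prob_halted
  have hadd : ∀ n, (run T n).toOuterMeasure {c | c.stage = .halted} +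
      (run T n).toOuterMeasure {c | c.stage ≠ .halted} = 1 := by
    intro n
    rw [toOuterMeasure_eq_mean, toOuterMeasure_eq_mean, ← mean_add]
    refine Eq.trans (congrArg _ (funext fun c => ?_)) (mean_const (run T n) 1)
    by_cases h : c.stage = .halted <;> simp [h]
  rw [h1]
  refine le_antisymm (iSup_le fun n => (hadd n ▸ le_self_add)) ?_
  refine ENNReal.le_of_forall_pos_le_add fun ε hε _ => ?_
  -- Markov bounds the probability of still running after `2n` steps by a constant over `n`, so a
  -- large `n` makes it at most `ε`.
  obtain ⟨n, hn⟩ := ENNReal.exists_nat_mul_gt (a := ε) (b := ENNReal.ofReal (600 * √(N : ℝ)))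
    (by simpa using hε.ne') ENNReal.ofReal_ne_top
  have hle : (run T (2 * n)).toOuterMeasure {c | c.stage ≠ .halted} ≤ ε := by
    by_contra hlt
    push Not at hlt
    exact absurd ((mul_le_mul_right hlt.le _).trans (prob_not_halted_le (T := T) hN n))
      (not_le.2 hn)
  rw [← hadd (2 * n)]
  exact add_le_add (le_iSup (fun n => (run T n).toOuterMeasure {c | c.stage = .halted}) _) hle

/-- Passage to the complement: return probabilities sum to 1, and by distinctness every other index
has nonzero rank, so together the others receive at most `1/2`. -/
theorem half_le_returnProb (hN : 2 ≤ N) (hT : Function.Injective T) {y : Fin N}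
    (hy : ∀ j, T y ≤ T j) : 1 / 2 ≤ returnProb T y := by
  have hsum := sum_returnProb (T := T) hN
  rw [← Finset.add_sum_erase _ _ (Finset.mem_univ y)] at hsum
  have hrest : ∑ z ∈ Finset.univ.erase y, returnProb T z ≤ 1 / 2 := by
    simp only [returnProb]
    rw [ENNReal.finsetSum_iSup_of_monotone fun y n m h => prob_halted_mono h y]
    refine iSup_le fun n => le_trans ?_ (prob_halted_not_min_le hT n)
    simp only [toOuterMeasure_eq_mean, mean]
    rw [← Summable.tsum_finsetSum fun _ _ => ENNReal.summable]
    refine ENNReal.tsum_le_tsum fun c => ?_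
    rw [← Finset.mul_sum]
    refine mul_le_mul_right ?_ _
    have hmin : rank T y = 0 := (rank_eq_zero_iff T).2 hy
    by_cases h : c.stage = .halted
    · by_cases hc : c.threshold = y
      · rw [Finset.sum_eq_zero]
        · exact zero_le
        · intro z hz
          have : c.threshold ≠ z := by
            rw [hc]
            exact (Finset.ne_of_mem_erase hz).symm
          simp [this]
      · have hr : rank T c.threshold ≠ 0 := fun h0 =>
          hc (rank_injective hT (h0.trans hmin.symm))
        have hz : ∀ z, {c : Config N | c.stage = .halted ∧ c.threshold = z}.indicator
            (fun _ => (1 : ℝ≥0∞)) c = if c.threshold = z then 1 else 0 := by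
          intro z
          by_cases hz : c.threshold = z <;> simp [h, hz]
        simp [hz, h, hr, hc]
    · simp [h]
  have h2 : (1 : ℝ≥0∞) / 2 + 1 / 2 ≤ returnProb T y + 1 / 2 := by
    rw [ENNReal.add_halves]
    exact hsum.ge.trans (add_le_add le_rfl hrest)
  exact (ENNReal.add_le_add_iff_right (by simp)).1 h2

end Chain

end QuantumMinimum

end

theorem theorem1 :
    ∃ C : ℝ, ∀ (N : ℕ) [NeZero N], 2 ≤ N →
      ∀ {α : Type*} [LinearOrder α] (T : Fin N → α), Function.Injective T →
        -- with probability 1 the algorithm halts and returns an index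
        (∑ y, QuantumMinimum.returnProb T y = 1) ∧
        -- the index of the minimum is returned with probability at least 1/2
        (∃ y, (∀ j, T y ≤ T j) ∧ 1 / 2 ≤ QuantumMinimum.returnProb T y) ∧
        -- the running time is always at most `C √N`
        (∀ n, ∀ c ∈ (QuantumMinimum.run T n).support, c.time ≤ C * √(N : ℝ)) ∧
        -- the expected number of probes is at most `C √N`
        QuantumMinimum.expectedProbes T ≤ ENNReal.ofReal (C * √(N : ℝ)) := by
  -- Here `600 = 3 * 200`: three probes per unit of time, with total time at most `200 * √N`.
  refine ⟨600, fun N _ hN α _ T hT => ⟨QuantumMinimum.sum_returnProb hN, ?_, ?_, ?_⟩⟩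
  · obtain ⟨y, hy⟩ := Finite.exists_min T
    exact ⟨y, hy, QuantumMinimum.half_le_returnProb hN hT hy⟩
  · intro n c hc
    have h1 := QuantumMinimum.time_le_of_mem_support_run hN hc
    have h2 := QuantumMinimum.timeLimit_add_logb_le (N := N) (by omega)
    have h3 : 0 ≤ √(N : ℝ) := Real.sqrt_nonneg _
    linarith
  · exact iSup_le fun n => QuantumMinimum.mean_run_probes_le hN n
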